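/- Let $H$ be a complex Hilbert space and let $M\subset B(H)$ be a von Neumann algebra, i.e. a $*$-subalgebra with $M=M''$. Let $M_*\subset M^*$ be its predual, i.e. the space of normal functionals: the norm closure in $M^*$ of the linear span of the functionals $x\mapsto\langle x\xi,\eta\rangle$, $\xi,\eta\in H$. Let $(M_*)_{sa}$ be the real Banach space, with the norm of $M^*$, of all $\varphi\in M_*$ such that $\varphi(x)=\overline{\varphi(x^*)}$ for every $x\in M$. Then: 1. $(M_*)_{sa}$ is $1$-Plichko; 2. $(M_*)_{sa}$ is weakly Lindelöf determined (WLD) if and only if $M$ is $\sigma$-finite; 3. if $M$ is $\sigma$-finite, then $(M_*)_{sa}$ is weakly compactly generated (WCG). Here, for a real Banach space $X$ and a linear subspace $D\subset X^*$, put $\|x\|_D=\sup\{|f(x)|: f\in D,\ \|f\|\le 1\}$. The subspace $D$ is norming if $\|\cdot\|_D$ is an equivalent norm on $X$, and $1$-norming if $\|\cdot\|_D=\|\cdot\|$. It is a $\Sigma$-subspace of $X^*$ if it is norming and there is a set $S\subset X$ with dense linear span such that $D=\{f\in X^*:\{m\in S: f(m)\neq 0\}\text{ is countable}\}$. The space $X$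 is $1$-Plichko if $X^*$ has a $1$-norming $\Sigma$-subspace; it is WLD if $X^*$ is a $\Sigma$-subspace of itself; it is WCG if some weakly compact subset of $X$ has dense linear span. The algebra $M$ is $\sigma$-finite if every set of pairwise orthogonal projections in $M$ is countable. -/

import Mathlib

open scoped ComplexConjugate

section BanachSpaces

variable (𝕜 : Type*) [RCLike 𝕜] (X : Type*) [NormedAddCommGroup X] [NormedSpace 𝕜 X]

variable {𝕜 X} in
/-- The seminorm `‖x‖_D = sup {|f x| : f ∈ D, ‖f‖ ≤ 1}` given by a linear subspace `D` of the dual.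
The set of values contains `0` and is bounded above by `‖x‖`, so this is a genuine supremum. -/
noncomputable def dualSubspaceNorm (D : Submodule 𝕜 (StrongDual 𝕜 X)) (x : X) : ℝ :=
  sSup {r : ℝ | ∃ f ∈ D, ‖f‖ ≤ 1 ∧ r = ‖f x‖}

variable {𝕜 X} in
/-- `D ⊆ X*` is norming: `‖·‖_D` is an equivalent norm on `X`. -/
def IsNormingSubspace (D : Submodule 𝕜 (StrongDual 𝕜 X)) : Prop :=
  ∃ c > 0, ∃ C > 0, ∀ x : X, c * ‖x‖ ≤ dualSubspaceNorm D x ∧ dualSubspaceNorm D x ≤ C * ‖x‖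

variable {𝕜 X} in
/-- `D ⊆ X*` is 1-norming: `‖·‖_D = ‖·‖`. -/
def IsOneNormingSubspace (D : Submodule 𝕜 (StrongDual 𝕜 X)) : Prop :=
  ∀ x : X, dualSubspaceNorm D x = ‖x‖

variable {𝕜 X} in
/-- A Σ-subspace of `X*`: a norming linear subspace `D` which, for some linearly dense `S ⊆ X`,
consists of those functionals that are nonzero at only countably many elements of `S`. -/
def IsSigmaSubspace (D : Submodule 𝕜 (StrongDual 𝕜 X)) : Prop :=
  IsNormingSubspace D ∧
    ∃ S : Set X, Dense (Submodule.span 𝕜 S : Set X) ∧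
      ∀ f : StrongDual 𝕜 X, f ∈ D ↔ {m ∈ S | f m ≠ 0}.Countable

/-- The Banach space `X` is 1-Plichko: its dual contains a 1-norming Σ-subspace. -/
def IsOnePlichko [CompleteSpace X] : Prop :=
  ∃ D : Submodule 𝕜 (StrongDual 𝕜 X), IsOneNormingSubspace D ∧ IsSigmaSubspace D

/-- The Banach space `X` is weakly Lindelöf determined (WLD): the whole dual is a Σ-subspace. -/
def IsWLD [CompleteSpace X] : Prop :=
  IsSigmaSubspace (⊤ : Submodule 𝕜 (StrongDual 𝕜 X))

/-- The Banach space `X` is weakly compactly generated (WCG): some weakly compact subset of `X`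
has dense linear span. -/
def IsWCG [CompleteSpace X] : Prop :=
  ∃ K : Set X, IsCompact (toWeakSpace 𝕜 X '' K) ∧ Dense (Submodule.span 𝕜 K : Set X)

end BanachSpaces

namespace VonNeumannAlgebra

variable {H : Type*} [NormedAddCommGroup H] [InnerProductSpace ℂ H] [CompleteSpace H]

/-- The vector functional `x ↦ ⟨x ξ, η⟩` on `M` (Mathlib's inner product is linear in its second
argument). -/
noncomputable def vectorFunctional (M : VonNeumannAlgebra H) (ξ η : H) :
    StrongDual ℂ M.toStarSubalgebra :=
  LinearMap.mkContinuous
    { toFun := fun x => inner ℂ η ((x : H →L[ℂ] H) ξ)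
      map_add' := fun x y => by simp
      map_smul' := fun c x => by simp }
    (‖η‖ * ‖ξ‖)
    (fun x => by
      calc ‖inner ℂ η ((x : H →L[ℂ] H) ξ)‖ ≤ ‖η‖ * ‖(x : H →L[ℂ] H) ξ‖ := norm_inner_le_norm _ _
        _ ≤ ‖η‖ * (‖(x : H →L[ℂ] H)‖ * ‖ξ‖) := by gcongr; exact ContinuousLinearMap.le_opNorm _ _
        _ = ‖η‖ * ‖ξ‖ * ‖x‖ := by rw [show ‖x‖ = ‖(x : H →L[ℂ] H)‖ from rfl]; ring)

/-- The predual `M_*` of `M`, as a subspace of the Banach space dual `M^*`: the normal (that is,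
ultraweakly continuous) functionals, i.e. the norm closure in `M^*` of the linear span of the
vector functionals. -/
noncomputable def predual (M : VonNeumannAlgebra H) :
    Submodule ℂ (StrongDual ℂ M.toStarSubalgebra) :=
  (Submodule.span ℂ {φ | ∃ ξ η : H, φ = M.vectorFunctional ξ η}).topologicalClosure

/-- The self-adjoint part of the predual: the real normed space, with the norm of `M^*`, of all
normal functionals `φ` such that `φ x` is the conjugate of `φ (x*)` for every `x`. -/
noncomputable def predualSA (M : VonNeumannAlgebra H) :
    Submodule ℝ (StrongDual ℂ M.toStarSubalgebra) where
  carrier := {φ | φ ∈ M.predual ∧ ∀ x : M.toStarSubalgebra, conj (φ (star x)) = φ x}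
  add_mem' := fun {φ ψ} hφ hψ => ⟨add_mem hφ.1 hψ.1, fun x => by simp [hφ.2 x, hψ.2 x]⟩
  zero_mem' := ⟨zero_mem _, fun x => by simp⟩
  smul_mem' := fun c φ hφ => ⟨by
    have h := M.predual.smul_mem (c : ℂ) hφ.1
    rwa [show ((c : ℂ) • φ) = c • φ from by ext x; simp] at h,
    fun x => by simp [hφ.2 x]⟩

theorem isClosed_predualSA (M : VonNeumannAlgebra H) :
    IsClosed (M.predualSA : Set (StrongDual ℂ M.toStarSubalgebra)) := by
  have h1 : IsClosed (M.predual : Set (StrongDual ℂ M.toStarSubalgebra)) :=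
    Submodule.isClosed_topologicalClosure _
  have h2 : IsClosed {φ : StrongDual ℂ M.toStarSubalgebra |
      ∀ x : M.toStarSubalgebra, conj (φ (star x)) = φ x} := by
    simp only [Set.ofPred_forall]
    refine isClosed_iInter fun x => isClosed_eq ?_ ?_
    · exact Complex.continuous_conj.comp
        (ContinuousLinearMap.apply ℂ ℂ (star x)).continuous
    · exact (ContinuousLinearMap.apply ℂ ℂ x).continuous
  exact h1.inter h2

/-- The self-adjoint part of the predual is a Banach space. -/
instance instCompleteSpacePredualSA (M : VonNeumannAlgebra H) : CompleteSpace M.predualSA :=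
  M.isClosed_predualSA.completeSpace_coe

/-- `M` is σ-finite: any set of pairwise orthogonal projections in `M` is countable. -/
def IsSigmaFinite (M : VonNeumannAlgebra H) : Prop :=
  ∀ P : Set M.toStarSubalgebra, (∀ p ∈ P, IsStarProjection p) →
    P.Pairwise (fun p q => p * q = 0) → P.Countable

end VonNeumannAlgebra

/-!
Write `T ξ η` for the self-adjoint normal functional `x ↦ ⟨x ξ, η⟩ + ⟨x η, ξ⟩`. For fixed `ξ` it
is a bounded real-linear map of `η`, so it carries the real Hilbert space underlying `H` into the
self-adjoint part `X` of the predual. Everything follows from having enough of these operators.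

By Zorn's lemma there is a maximal set `E` of nonzero vectors whose invariant subspaces `[M' ξ]`
under the commutant `M'` are pairwise orthogonal, and maximality makes these subspaces span `H`.
Since `T (y ξ) η = T ξ (y* η)` for `y ∈ M'`, the ranges of the operators `T ξ`, `ξ ∈ E`, span a
dense subspace of `X` (`dense_of_symVectorFunctional_mem_of_cyclicSpace_eq_top`). Hence, for an
orthonormal basis `b` of the real Hilbert space `H`, the set `S = {T ξ (b j)}` is linearly dense.
By Riesz and Bessel, a bounded functional composed with a single `T ξ` vanishes at all but
countably many `b j`.

* `X` is 1-Plichko: let `D` be the space of functionals that are countably supported on `S`. For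
  finite `F ⊆ E`, let `p` be the projection onto the span of the `[M' ξ]`, `ξ ∈ F`; it lies in `M`.
  Evaluation at `p x p` kills `T ξ` for `ξ ∈ E \ F`, so it belongs to `D`. As `F` grows, `p`
  converges strongly to `1`, so `φ (p x p)` converges to `φ x` for normal `φ`; therefore `D` is
  1-norming.
* If `M` is σ-finite, then `E` is countable, since the projections onto `[M' ξ]` are orthogonal.
  Then every functional is countably supported on `S`, which gives WLD, and multiplying `T ξ` by
  suitable positive constants makes the family `T ξ (b j)` weakly null, so that with `0` it forms a
  weakly compact linearly dense set.
* If `X` is WLD, a family `P` of nonzero orthogonal projections gives functionals `m ↦ m p` on `X`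
  which are uniformly `ℓ¹`-bounded and, up to nonzero factors, biorthogonal to elements of `X`.
  A closing-off argument (`countable_of_biorthogonal`) yields a countable `A ⊆ P` such that
  `∑_{p ∉ A} m p` vanishes on a linearly dense set, hence identically; so `P = A`.
-/

open Filter Topology

/-! ### Countably supported functionals on Banach spaces -/

section BanachSpaces

variable {X : Type*} [NormedAddCommGroup X] [NormedSpace ℝ X]

theorem bddAbove_dualSubspaceNorm (D : Submodule ℝ (StrongDual ℝ X)) (x : X) :
    BddAbove {r : ℝ | ∃ f ∈ D, ‖f‖ ≤ 1 ∧ r = ‖f x‖} := by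
  refine ⟨‖x‖, ?_⟩
  rintro r ⟨f, -, hf, rfl⟩
  simpa using f.le_of_opNorm_le hf x

theorem dualSubspaceNorm_le (D : Submodule ℝ (StrongDual ℝ X)) (x : X) :
    dualSubspaceNorm D x ≤ ‖x‖ := by
  refine csSup_le ⟨0, 0, zero_mem _, by simp, by simp⟩ ?_
  rintro r ⟨f, -, hf, rfl⟩
  simpa using f.le_of_opNorm_le hf x

theorem norm_apply_le_mul_dualSubspaceNorm {D : Submodule ℝ (StrongDual ℝ X)}
    {f : StrongDual ℝ X} (hf : f ∈ D) {c : ℝ} (hc : 0 ≤ c) (hfc : ‖f‖ ≤ c) (x : X) :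
    ‖f x‖ ≤ c * dualSubspaceNorm D x := by
  rcases hc.eq_or_lt with rfl | hc
  · have : f = 0 := norm_le_zero_iff.1 hfc
    simp [this]
  · have : ‖(c⁻¹ • f) x‖ ≤ dualSubspaceNorm D x := by
      refine le_csSup (bddAbove_dualSubspaceNorm D x) ⟨_, D.smul_mem _ hf, ?_, rfl⟩
      rw [norm_smul, norm_inv, Real.norm_of_nonneg hc.le, inv_mul_le_iff₀ hc]
      simpa using hfc
    rw [smul_apply, norm_smul, norm_inv, Real.norm_of_nonneg hc.le,
      inv_mul_le_iff₀ hc] at this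
    exact this

theorem IsOneNormingSubspace.isNormingSubspace {D : Submodule ℝ (StrongDual ℝ X)}
    (h : IsOneNormingSubspace D) : IsNormingSubspace D :=
  ⟨1, one_pos, 1, one_pos, fun x => by rw [h x]; simp⟩

theorem isOneNormingSubspace_top :
    IsOneNormingSubspace (⊤ : Submodule ℝ (StrongDual ℝ X)) := by
  intro x
  refine le_antisymm (dualSubspaceNorm_le _ _) ?_
  obtain ⟨g, hg, hgx⟩ := exists_dual_vector'' ℝ x
  refine le_csSup (bddAbove_dualSubspaceNorm _ x) ⟨g, trivial, hg, ?_⟩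
  simp [hgx]

/-- The functionals vanishing at all but countably many points of `S`. -/
def countablySupported (S : Set X) : Submodule ℝ (StrongDual ℝ X) where
  carrier := {f | {m ∈ S | f m ≠ 0}.Countable}
  zero_mem' := by simp
  add_mem' := fun {f g} hf hg => by
    refine (Set.Countable.union hf hg).mono ?_
    rintro m ⟨hm, h⟩
    by_contra hn
    simp only [Set.mem_union, Set.mem_ofPred_eq, hm, true_and, not_or, not_not] at hn
    exact h (by simp [hn.1, hn.2])
  smul_mem' := fun c f hf => by
    refine Set.Countable.mono ?_ hf
    rintro m ⟨hm, h⟩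
    exact ⟨hm, fun h0 => h (by simp [h0])⟩

/-- A family of functionals that is uniformly `ℓ¹`-bounded and admits a biorthogonal family of
vectors is countable when every functional on `X` is nonzero at only countably many points of a
linearly dense set. -/
theorem countable_of_biorthogonal {S : Set X} (hS : Dense (Submodule.span ℝ S : Set X))
    (hf : ∀ f : StrongDual ℝ X, {m ∈ S | f m ≠ 0}.Countable) {P : Type*}
    (g : P → StrongDual ℝ X) {C : ℝ} (hg : ∀ (F : Finset P) (x : X), ∑ p ∈ F, ‖g p x‖ ≤ C * ‖x‖)
    (e : P → X) (he : ∀ p, g p (e p) ≠ 0) (heg : ∀ p q, p ≠ q → g q (e p) = 0) : Countable P := by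
  have hsum : ∀ x, Summable fun p => ‖g p x‖ := fun x =>
    summable_of_sum_le (fun _ => norm_nonneg _) (fun F => hg F x)
  have hsumA : ∀ (A : Set P) x, Summable (A.indicator fun p => g p x) := fun A x =>
    (hsum x).of_norm.indicator A
  -- `G A` is the functional `∑_{p ∈ A} g p`
  let G : Set P → StrongDual ℝ X := fun A => LinearMap.mkContinuous
    { toFun := fun x => ∑' p, A.indicator (fun p => g p x) p
      map_add' := fun x y => by
        rw [← (hsumA A x).tsum_add (hsumA A y)]
        refine tsum_congr fun p => ?_
        by_cases hp : p ∈ A <;> simp [hp]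
      map_smul' := fun c x => by
        rw [RingHom.id_apply, smul_eq_mul, ← tsum_mul_left]
        refine tsum_congr fun p => ?_
        by_cases hp : p ∈ A <;> simp [hp] } C (fun x => by
      refine (norm_tsum_le_tsum_norm (hsumA A x).norm).trans ?_
      refine (((hsumA A x).norm).tsum_le_tsum (fun p => ?_) (hsum x)).trans
        ((hsum x).tsum_le_of_sum_le fun F => hg F x)
      by_cases hp : p ∈ A <;> simp [hp])
  have hG : ∀ A x, G A x = ∑' p, A.indicator (fun p => g p x) p := fun _ _ => rfl
  have hcount : ∀ x, {p | g p x ≠ 0}.Countable := fun x =>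
    (hsum x).of_norm.countable_support
  -- `A` is a countable set absorbing the supports of all `m ∈ S` that meet it, and of all `m ∈ S`
  -- at which `G univ` is nonzero
  let next : Set P → Set P := fun A => ⋃ p ∈ A, ⋃ m ∈ {m ∈ S | g p m ≠ 0}, {q | g q m ≠ 0}
  let start : Set P := ⋃ m ∈ {m ∈ S | G Set.univ m ≠ 0}, {q | g q m ≠ 0}
  let A : Set P := ⋃ n : ℕ, next^[n] start
  have hA : A.Countable := by
    refine Set.countable_iUnion fun n => ?_
    induction n with
    | zero => exact (hf _).biUnion fun m _ => hcount m
    | succ n ih =>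
      rw [Function.iterate_succ_apply']
      exact ih.biUnion fun p _ => (hf _).biUnion fun m _ => hcount m
  have hAstart : ∀ m ∈ S, G Set.univ m ≠ 0 → ∀ q, g q m ≠ 0 → q ∈ A := fun m hm h q hq =>
    Set.mem_iUnion.2 ⟨0, Set.mem_biUnion (x := m) ⟨hm, h⟩ hq⟩
  have hAnext : ∀ m ∈ S, ∀ p ∈ A, g p m ≠ 0 → ∀ q, g q m ≠ 0 → q ∈ A := by
    intro m hm p hp h q hq
    obtain ⟨n, hn⟩ := Set.mem_iUnion.1 hp
    refine Set.mem_iUnion.2 ⟨n + 1, ?_⟩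
    rw [Function.iterate_succ_apply']
    exact Set.mem_biUnion hn (Set.mem_biUnion (x := m) ⟨hm, h⟩ hq)
  have hvanish : ∀ m ∈ S, G Aᶜ m = 0 := by
    intro m hm
    by_cases hsupp : ∀ q, g q m ≠ 0 → q ∈ A
    · have : ∀ p, Aᶜ.indicator (fun p => g p m) p = 0 := fun p =>
        Set.indicator_apply_eq_zero.2 fun hp => by_contra fun h => hp (hsupp p h)
      rw [hG, tsum_congr this, tsum_zero]
    · have h1 : G Set.univ m = 0 := by_contra fun h => hsupp (hAstart m hm h)
      have h2 : ∀ p ∈ A, g p m = 0 := fun p hp => by_contra fun h => hsupp (hAnext m hm p hp h)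
      rw [← h1, hG, hG]
      refine tsum_congr fun p => ?_
      by_cases hp : p ∈ A
      · simp [hp, h2 p hp]
      · simp [hp]
  have hzero : G Aᶜ = 0 := by
    refine ContinuousLinearMap.ext_on hS fun m hm => ?_
    simpa using hvanish m hm
  have hAuniv : A = Set.univ := by
    refine Set.eq_univ_of_forall fun p => by_contra fun hp => he p ?_
    have h : G Aᶜ (e p) = g p (e p) := by
      rw [hG, tsum_eq_single p fun q hq => ?_]
      · simp [hp]
      · simp [heg p q hq.symm]
    rw [← h, hzero]
    rfl
  exact Set.countable_univ_iff.1 (hAuniv ▸ hA)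

/-! ### Banach spaces spanned by images of a Hilbert space -/

variable {K : Type*} [NormedAddCommGroup K] [InnerProductSpace ℝ K] [CompleteSpace K]

theorem exists_inner_eq (g : StrongDual ℝ K) : ∃ v : K, ‖v‖ = ‖g‖ ∧ ∀ w, g w = inner ℝ v w :=
  ⟨(InnerProductSpace.toDual ℝ K).symm g, by simp, fun w => by simp⟩

theorem Orthonormal.summable_apply_sq {ι : Type*} {b : ι → K} (hb : Orthonormal ℝ b)
    (g : StrongDual ℝ K) : Summable (fun j => g (b j) ^ 2) ∧ ∑' j, g (b j) ^ 2 ≤ ‖g‖ ^ 2 := by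
  obtain ⟨v, hv, h⟩ := exists_inner_eq g
  have : ∀ j, g (b j) ^ 2 = ‖inner ℝ (b j) v‖ ^ 2 := fun j => by
    rw [h, real_inner_comm, Real.norm_eq_abs, sq_abs]
  simp only [this, ← hv]
  exact ⟨hb.inner_products_summable v, hb.tsum_inner_products_le v⟩

theorem Orthonormal.countable_apply_ne_zero {ι : Type*} {b : ι → K} (hb : Orthonormal ℝ b)
    (g : StrongDual ℝ K) : {j | g (b j) ≠ 0}.Countable := by
  refine (hb.summable_apply_sq g).1.countable_support.mono fun j hj => ?_
  simpa using hj

omit [CompleteSpace K] in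
/-- If the ranges of the operators `T i` span a dense subspace, so do nonzero multiples of the
images of an orthonormal basis. -/
theorem dense_span_of_hilbertBasis {I ι : Type*} (T : I → K →L[ℝ] X)
    (hT : ∀ V : Submodule ℝ X, (∀ i w, T i w ∈ V.topologicalClosure) → Dense (V : Set X))
    (b : HilbertBasis ι ℝ K) {S : Set X} (c : I → ℝ) (hc : ∀ i, c i ≠ 0)
    (hS : ∀ i j, c i • T i (b j) ∈ S) : Dense (Submodule.span ℝ S : Set X) := by
  refine hT _ fun i w => ?_
  have hle : (⊤ : Submodule ℝ K) ≤
      ((Submodule.span ℝ S).topologicalClosure).comap (T i : K →ₗ[ℝ] X) := by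
    rw [← b.dense_span]
    refine Submodule.topologicalClosure_minimal _ (Submodule.span_le.2 ?_) ?_
    · rintro _ ⟨j, rfl⟩
      have := (Submodule.span ℝ S).smul_mem (c i)⁻¹ (Submodule.subset_span (hS i j))
      rw [inv_smul_smul₀ (hc i)] at this
      exact Submodule.le_topologicalClosure _ this
    · exact (Submodule.isClosed_topologicalClosure _).preimage (T i).continuous
  exact hle (Submodule.mem_top (x := w))

/-- A space that is the closed linear span of the ranges of countably many operators defined on a
Hilbert space is weakly compactly generated: shrinking the images of an orthonormal basis
suitably gives a weakly null family. -/
theorem isWCG_of_countable_hilbert [CompleteSpace X] {I : Type*} [Countable I]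
    (T : I → K →L[ℝ] X)
    (hT : ∀ V : Submodule ℝ X, (∀ i w, T i w ∈ V.topologicalClosure) → Dense (V : Set X)) :
    IsWCG ℝ X := by
  obtain ⟨s, b, -⟩ := exists_hilbertBasis ℝ K
  have : Encodable I := Encodable.ofCountable I
  obtain ⟨d, hd, _, hdsum, -⟩ := posSumOfEncodable (ε := 1) one_pos I
  -- the factors are chosen so that `∑ i, (c i * ‖T i‖) ^ 2 < ∞`
  let c : I → ℝ := fun i => √(d i) / (1 + ‖T i‖)
  have hc : ∀ i, 0 < c i := fun i => div_pos (Real.sqrt_pos.2 (hd i)) (by positivity)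
  have hcT : ∀ i, c i ^ 2 * ‖T i‖ ^ 2 ≤ d i := fun i => by
    rw [div_pow, Real.sq_sqrt (hd i).le, div_mul_eq_mul_div, div_le_iff₀ (by positivity)]
    gcongr
    · exact (hd i).le
    · linarith
  let a : I × s → X := fun q => c q.1 • T q.1 (b q.2)
  have hsq : ∀ f : StrongDual ℝ X, Summable fun q => f (a q) ^ 2 := by
    intro f
    have hfi : ∀ i j, f (a (i, j)) ^ 2 = c i ^ 2 * (f.comp (T i)) (b j) ^ 2 := fun i j => by
      simp [a, mul_pow]
    refine (summable_prod_of_nonneg fun q => sq_nonneg _).2 ⟨fun i => ?_, ?_⟩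
    · simp only [hfi]
      exact (b.orthonormal.summable_apply_sq (f.comp (T i))).1.mul_left _
    · refine Summable.of_nonneg_of_le (fun i => tsum_nonneg fun j => sq_nonneg _) (fun i => ?_)
        (hdsum.summable.mul_left (‖f‖ ^ 2))
      simp only [hfi, tsum_mul_left]
      calc c i ^ 2 * ∑' j, (f.comp (T i)) (b j) ^ 2
          ≤ c i ^ 2 * (‖f‖ * ‖T i‖) ^ 2 := by
            gcongr
            exact (b.orthonormal.summable_apply_sq _).2.trans
              (pow_le_pow_left₀ (norm_nonneg _) (f.opNorm_comp_le _) 2)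
        _ = ‖f‖ ^ 2 * (c i ^ 2 * ‖T i‖ ^ 2) := by ring
        _ ≤ ‖f‖ ^ 2 * d i := by gcongr; exact hcT i
  have hlim : Tendsto (fun q => toWeakSpace ℝ X (a q)) cofinite (𝓝 (0 : WeakSpace ℝ X)) := by
    have hinj : Function.Injective (topDualPairing ℝ X).flip := fun x y hxy =>
      (SeparatingDual.eq_iff_forall_dual_eq (R := ℝ)).2 fun f => LinearMap.congr_fun hxy f
    refine (WeakBilin.tendsto_iff_forall_eval_tendsto _ hinj).2 fun f => ?_
    have h := ((hsq f).tendsto_cofinite_zero).sqrt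
    simp only [Real.sqrt_sq_eq_abs, Real.sqrt_zero] at h
    have h0 : (topDualPairing ℝ X).flip (0 : X) f = 0 := map_zero f
    exact h0 ▸ (tendsto_zero_iff_abs_tendsto_zero _).2 h
  refine ⟨insert 0 (Set.range a), ?_, dense_span_of_hilbertBasis T hT b c (fun i => (hc i).ne')
    fun i j => Set.mem_insert_of_mem _ ⟨(i, j), rfl⟩⟩
  rw [Set.image_insert_eq, map_zero, ← Set.range_comp]
  exact hlim.isCompact_insert_range_of_cofinite

/-- A space that is the closed linear span of the ranges of countably many operators defined on a
Hilbert space is weakly Lindelöf determined. -/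
theorem isWLD_of_countable_hilbert [CompleteSpace X] {I : Type*} [Countable I]
    (T : I → K →L[ℝ] X)
    (hT : ∀ V : Submodule ℝ X, (∀ i w, T i w ∈ V.topologicalClosure) → Dense (V : Set X)) :
    IsWLD ℝ X := by
  obtain ⟨s, b, -⟩ := exists_hilbertBasis ℝ K
  refine ⟨isOneNormingSubspace_top.isNormingSubspace, ⋃ i, Set.range fun j => T i (b j),
    dense_span_of_hilbertBasis T hT b (fun _ => 1) (fun _ => one_ne_zero) fun i j =>
      Set.mem_iUnion.2 ⟨i, j, (one_smul _ _).symm⟩, fun f => ⟨fun _ => ?_, fun _ => trivial⟩⟩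
  refine (Set.countable_iUnion fun i =>
    (b.orthonormal.countable_apply_ne_zero (f.comp (T i))).image fun j => T i (b j)).mono ?_
  rintro _ ⟨hm, hne⟩
  obtain ⟨i, j, rfl⟩ := Set.mem_iUnion.1 hm
  exact Set.mem_iUnion.2 ⟨i, j, hne, rfl⟩

end BanachSpaces

namespace VonNeumannAlgebra

variable {H : Type*} [NormedAddCommGroup H] [InnerProductSpace ℂ H] [CompleteSpace H]
  (M : VonNeumannAlgebra H)

/-! ### Self-adjoint vector functionals -/

@[simp]
theorem vectorFunctional_apply (ξ η : H) (x : M.toStarSubalgebra) :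
    M.vectorFunctional ξ η x = inner ℂ η ((x : H →L[ℂ] H) ξ) := rfl

theorem norm_vectorFunctional_le (ξ η : H) : ‖M.vectorFunctional ξ η‖ ≤ ‖η‖ * ‖ξ‖ :=
  LinearMap.mkContinuous_norm_le _ (by positivity) _

theorem vectorFunctional_mem_predual (ξ η : H) : M.vectorFunctional ξ η ∈ M.predual :=
  Submodule.le_topologicalClosure _ (Submodule.subset_span ⟨ξ, η, rfl⟩)

theorem conj_vectorFunctional_star (ξ η : H) (x : M.toStarSubalgebra) :
    conj (M.vectorFunctional ξ η (star x)) = M.vectorFunctional η ξ x := by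
  simp [ContinuousLinearMap.star_eq_adjoint, ContinuousLinearMap.adjoint_inner_right]

/-- The self-adjoint part of the predual as a type of its own. The submodule `M.predualSA` sits in a
complex dual space, whose real structure comes from several instance paths; the synonym keeps them
apart. -/
def SelfAdjointPredual : Type _ := M.predualSA

noncomputable instance : NormedAddCommGroup M.SelfAdjointPredual :=
  inferInstanceAs (NormedAddCommGroup M.predualSA)

noncomputable instance : NormedSpace ℝ M.SelfAdjointPredual :=
  inferInstanceAs (NormedSpace ℝ M.predualSA)

instance : CompleteSpace M.SelfAdjointPredual :=
  inferInstanceAs (CompleteSpace M.predualSA)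

/-- The functional underlying an element of the self-adjoint part of the predual. -/
def toDual : M.SelfAdjointPredual →+ StrongDual ℂ M.toStarSubalgebra where
  toFun m := m.1
  map_zero' := rfl
  map_add' _ _ := rfl

theorem norm_toDual (m : M.SelfAdjointPredual) : ‖M.toDual m‖ = ‖m‖ := rfl

theorem isometry_toDual : Isometry M.toDual :=
  AddMonoidHomClass.isometry_of_norm _ M.norm_toDual

@[simp]
theorem toDual_smul_apply (c : ℝ) (m : M.SelfAdjointPredual) (x : M.toStarSubalgebra) :
    M.toDual (c • m) x = c * M.toDual m x := rfl

theorem toDual_mem_predual (m : M.SelfAdjointPredual) : M.toDual m ∈ M.predual := m.2.1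

theorem conj_toDual_star (m : M.SelfAdjointPredual) (x : M.toStarSubalgebra) :
    conj (M.toDual m (star x)) = M.toDual m x := m.2.2 x

variable {M} in
theorem toDual_ext {m n : M.SelfAdjointPredual} (h : ∀ x, M.toDual m x = M.toDual n x) : m = n :=
  M.isometry_toDual.injective (ContinuousLinearMap.ext h)

/-- The vector functional of `ξ, η` plus its adjoint, the vector functional of `η, ξ`. -/
noncomputable def vectorFunctionalAddAdjoint (ξ η : H) : M.SelfAdjointPredual :=
  (⟨M.vectorFunctional ξ η + M.vectorFunctional η ξ,
    add_mem (M.vectorFunctional_mem_predual _ _) (M.vectorFunctional_mem_predual _ _), fun x => by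
      rw [add_apply, map_add, conj_vectorFunctional_star, conj_vectorFunctional_star, add_apply,
        add_comm]⟩ : M.predualSA)

theorem vectorFunctionalAddAdjoint_apply (ξ η : H) (x : M.toStarSubalgebra) :
    M.toDual (M.vectorFunctionalAddAdjoint ξ η) x =
      inner ℂ η ((x : H →L[ℂ] H) ξ) + inner ℂ ξ ((x : H →L[ℂ] H) η) := rfl

/-- The self-adjoint functional `x ↦ ⟨x ξ, η⟩ + ⟨x η, ξ⟩`, as a real-linear continuous function of
the vector `η`. -/
noncomputable def symVectorFunctional (ξ : H) : H →L[ℝ] M.SelfAdjointPredual :=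
  LinearMap.mkContinuous
    { toFun := M.vectorFunctionalAddAdjoint ξ
      map_add' := fun η ζ => toDual_ext fun x => by
        rw [map_add, add_apply]
        simp only [vectorFunctionalAddAdjoint_apply, map_add, inner_add_left, inner_add_right]
        ring
      map_smul' := fun c η => toDual_ext fun x => by
        rw [RingHom.id_apply, toDual_smul_apply]
        simp only [vectorFunctionalAddAdjoint_apply, ← Complex.coe_smul, map_smul, inner_smul_left,
          inner_smul_right, Complex.conj_ofReal]
        ring } (2 * ‖ξ‖) (fun η => by
      refine (norm_add_le (M.vectorFunctional ξ η) (M.vectorFunctional η ξ)).trans ?_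
      have h1 := M.norm_vectorFunctional_le ξ η
      have h2 := M.norm_vectorFunctional_le η ξ
      linarith)

theorem toDual_symVectorFunctional (ξ η : H) :
    M.toDual (M.symVectorFunctional ξ η) = M.vectorFunctional ξ η + M.vectorFunctional η ξ := rfl

theorem symVectorFunctional_apply (ξ η : H) (x : M.toStarSubalgebra) :
    M.toDual (M.symVectorFunctional ξ η) x =
      inner ℂ η ((x : H →L[ℂ] H) ξ) + inner ℂ ξ ((x : H →L[ℂ] H) η) := rfl

theorem symVectorFunctional_comm (ξ η : H) :
    M.symVectorFunctional ξ η = M.symVectorFunctional η ξ :=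
  toDual_ext fun x => by rw [symVectorFunctional_apply, symVectorFunctional_apply, add_comm]

theorem symVectorFunctional_smul_left (c : ℂ) (ξ η : H) :
    M.symVectorFunctional (c • ξ) η = M.symVectorFunctional ξ (conj c • η) := by
  refine toDual_ext fun x => ?_
  simp [symVectorFunctional_apply]
  ring

/-- Elements of the commutant can be moved from one vector to the other. -/
theorem symVectorFunctional_commutant {y : H →L[ℂ] H} (hy : y ∈ M.commutant) (ξ η : H) :
    M.symVectorFunctional (y ξ) η = M.symVectorFunctional ξ (star y η) := by
  refine toDual_ext fun x => ?_
  have h1 : (x : H →L[ℂ] H) (y ξ) = y ((x : H →L[ℂ] H) ξ) :=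
    DFunLike.congr_fun (mem_commutant_iff.1 hy x x.2) ξ
  have h2 : (x : H →L[ℂ] H) (star y η) = star y ((x : H →L[ℂ] H) η) :=
    DFunLike.congr_fun (mem_commutant_iff.1 (star_mem hy) x x.2) η
  rw [symVectorFunctional_apply, symVectorFunctional_apply, h1, h2,
    ContinuousLinearMap.star_eq_adjoint, ContinuousLinearMap.adjoint_inner_left,
    ContinuousLinearMap.adjoint_inner_right]

/-- The additive map `φ ↦ φ + φ*`, where `φ* x` is the conjugate of `φ (x*)`. -/
noncomputable def symmetrize :
    StrongDual ℂ M.toStarSubalgebra →+ StrongDual ℂ M.toStarSubalgebra where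
  toFun φ := φ + LinearMap.mkContinuous
    { toFun := fun x => conj (φ (star x))
      map_add' := fun x y => by simp
      map_smul' := fun c x => by simp } ‖φ‖ (fun x => by
        rw [← norm_star x]
        change ‖conj (φ (star x))‖ ≤ _
        rw [RCLike.norm_conj]
        exact φ.le_opNorm (star x))
  map_zero' := by
    ext x
    simp
  map_add' φ ψ := by
    ext x
    simp only [add_apply, LinearMap.mkContinuous_apply, LinearMap.coe_mk, AddHom.coe_mk, map_add]
    ring

theorem symmetrize_apply (φ : StrongDual ℂ M.toStarSubalgebra) (x : M.toStarSubalgebra) :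
    M.symmetrize φ x = φ x + conj (φ (star x)) := rfl

theorem continuous_symmetrize : Continuous M.symmetrize := by
  refine AddMonoidHomClass.continuous_of_bound _ 2 fun φ => ?_
  refine (norm_add_le _ _).trans ?_
  rw [two_mul]
  gcongr
  exact LinearMap.mkContinuous_norm_le _ (norm_nonneg _) _

theorem symmetrize_smul_vectorFunctional (c : ℂ) (ξ η : H) :
    M.symmetrize (c • M.vectorFunctional ξ η) = M.toDual (M.symVectorFunctional (c • ξ) η) := by
  have : c • M.vectorFunctional ξ η = M.vectorFunctional (c • ξ) η := by
    ext x
    simp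
  ext x
  rw [this, symmetrize_apply, conj_vectorFunctional_star]
  rfl

/-- The functionals `T ξ η` span a dense subspace, because `φ = (φ / 2) + (φ / 2)*` for a
self-adjoint `φ` and `symmetrize` sends vector functionals to functionals `T ξ η`. -/
theorem dense_of_symVectorFunctional_mem (V : Submodule ℝ M.SelfAdjointPredual)
    (h : ∀ ξ η, M.symVectorFunctional ξ η ∈ V.topologicalClosure) :
    Dense (V : Set M.SelfAdjointPredual) := by
  let Y : AddSubgroup (StrongDual ℂ M.toStarSubalgebra) :=
    (V.toAddSubgroup.map M.toDual).topologicalClosure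
  have hY : ∀ m, M.toDual m ∈ Y ↔ m ∈ V.topologicalClosure := fun m => by
    rw [← SetLike.mem_coe, ← SetLike.mem_coe, Submodule.topologicalClosure_coe,
      M.isometry_toDual.isUniformInducing.isInducing.closure_eq_preimage_closure_image]
    rfl
  -- the functionals all of whose complex multiples have symmetrization in `Y`
  let N : Submodule ℂ (StrongDual ℂ M.toStarSubalgebra) :=
    { carrier := {φ | ∀ c : ℂ, M.symmetrize (c • φ) ∈ Y}
      zero_mem' := fun c => by
        rw [smul_zero, map_zero]
        exact zero_mem _
      add_mem' := fun {φ ψ} hφ hψ c => by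
        rw [smul_add, map_add]
        exact add_mem (hφ c) (hψ c)
      smul_mem' := fun d φ hφ c => by
        rw [smul_smul]
        exact hφ _ }
  have hNclosed : IsClosed (N : Set (StrongDual ℂ M.toStarSubalgebra)) := by
    have : (N : Set (StrongDual ℂ M.toStarSubalgebra)) =
        ⋂ c : ℂ, (fun φ => M.symmetrize (c • φ)) ⁻¹' Y := by
      ext φ
      simp only [Set.mem_iInter]
      rfl
    rw [this]
    exact isClosed_iInter fun c => (AddSubgroup.isClosed_topologicalClosure _).preimage
      (M.continuous_symmetrize.comp (continuous_const_smul c))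
  have hN : M.predual ≤ N := by
    refine Submodule.topologicalClosure_minimal _ (Submodule.span_le.2 ?_) hNclosed
    rintro _ ⟨ξ, η, rfl⟩ c
    rw [symmetrize_smul_vectorFunctional]
    exact (hY _).2 (h _ _)
  intro m
  have h2 : M.symmetrize ((2⁻¹ : ℂ) • M.toDual m) = M.toDual m := by
    ext x
    rw [symmetrize_apply, smul_apply, smul_apply, smul_eq_mul, smul_eq_mul, map_mul,
      conj_toDual_star, map_inv₀, Complex.conj_ofNat]
    ring
  have := (hY m).1 (h2 ▸ hN (M.toDual_mem_predual m) 2⁻¹)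
  rwa [← SetLike.mem_coe, Submodule.topologicalClosure_coe] at this

/-! ### Cyclic projections -/

/-- The closed linear span of the vectors `y ξ`, where `ξ ∈ A` and `y` is in the commutant. -/
noncomputable def cyclicSpace (A : Set H) : Submodule ℂ H :=
  (Submodule.span ℂ {v | ∃ y ∈ M.commutant, ∃ ξ ∈ A, v = y ξ}).topologicalClosure

noncomputable instance (A : Set H) : CompleteSpace (M.cyclicSpace A) :=
  Submodule.topologicalClosure.completeSpace _

theorem commutant_apply_mem_cyclicSpace {A : Set H} {ξ : H} (hξ : ξ ∈ A) {y : H →L[ℂ] H}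
    (hy : y ∈ M.commutant) : y ξ ∈ M.cyclicSpace A :=
  Submodule.le_topologicalClosure _ (Submodule.subset_span ⟨y, hy, ξ, hξ, rfl⟩)

theorem mem_cyclicSpace {A : Set H} {ξ : H} (hξ : ξ ∈ A) : ξ ∈ M.cyclicSpace A :=
  M.commutant_apply_mem_cyclicSpace hξ (one_mem M.commutant)

theorem cyclicSpace_le {A : Set H} {V : Submodule ℂ H} (hV : IsClosed (V : Set H))
    (h : ∀ y ∈ M.commutant, ∀ ξ ∈ A, y ξ ∈ V) : M.cyclicSpace A ≤ V := by
  refine Submodule.topologicalClosure_minimal _ (Submodule.span_le.2 ?_) hV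
  rintro _ ⟨y, hy, ξ, hξ, rfl⟩
  exact h y hy ξ hξ

theorem cyclicSpace_mono {A B : Set H} (h : A ⊆ B) : M.cyclicSpace A ≤ M.cyclicSpace B :=
  M.cyclicSpace_le (Submodule.isClosed_topologicalClosure _) fun _ hy _ hξ =>
    M.commutant_apply_mem_cyclicSpace (h hξ) hy

theorem mem_orthogonal_cyclicSpace {A : Set H} {η : H}
    (h : ∀ y ∈ M.commutant, ∀ ξ ∈ A, inner ℂ (y ξ) η = 0) : η ∈ (M.cyclicSpace A)ᗮ := by
  have : M.cyclicSpace A ≤ (ℂ ∙ η)ᗮ :=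
    M.cyclicSpace_le (Submodule.isClosed_orthogonal _) fun y hy ξ hξ =>
      Submodule.mem_orthogonal_singleton_iff_inner_left.2 (h y hy ξ hξ)
  intro v hv
  exact Submodule.mem_orthogonal_singleton_iff_inner_left.1 (this hv)

/-- The projection of `M` onto the invariant subspace of the commutant generated by `A`. -/
noncomputable def cyclicProjection (A : Set H) : M.toStarSubalgebra :=
  ⟨(M.cyclicSpace A).starProjection, by
    refine (IsStarProjection.mem_iff isStarProjection_starProjection M).2 fun y hy => ?_
    rw [Submodule.range_starProjection]
    refine (Module.End.mem_invtSubmodule _).2 (M.cyclicSpace_le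
      (V := (M.cyclicSpace A).comap (y : H →ₗ[ℂ] H))
      ((Submodule.isClosed_topologicalClosure _).preimage y.continuous) fun z hz ξ hξ => ?_)
    exact M.commutant_apply_mem_cyclicSpace hξ (mul_mem hy hz)⟩

theorem isStarProjection_cyclicProjection (A : Set H) :
    IsStarProjection (M.cyclicProjection A) := by
  have h : IsStarProjection (M.cyclicSpace A).starProjection := isStarProjection_starProjection
  exact ⟨Subtype.ext h.1, Subtype.ext h.2⟩

theorem norm_cyclicProjection_le (A : Set H) : ‖M.cyclicProjection A‖ ≤ 1 :=
  Submodule.starProjection_norm_le _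

/-- A set of nonzero vectors generating pairwise orthogonal invariant subspaces of the
commutant. -/
structure IsCyclicallyOrthogonal (E : Set H) : Prop where
  ne_zero : ∀ ξ ∈ E, ξ ≠ 0
  inner_eq_zero : E.Pairwise fun ξ ζ => ∀ y ∈ M.commutant, inner ℂ ξ (y ζ) = 0

/-- A maximal family of vectors with orthogonal invariant subspaces generates the whole space. -/
theorem exists_isCyclicallyOrthogonal_cyclicSpace_eq_top :
    ∃ E : Set H, M.IsCyclicallyOrthogonal E ∧ M.cyclicSpace E = ⊤ := by
  obtain ⟨E, hE⟩ := zorn_subset {E : Set H | M.IsCyclicallyOrthogonal E} fun c hc hchain =>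
    ⟨⋃₀ c, ⟨fun ξ ⟨E, hE, hξ⟩ => (hc hE).ne_zero ξ hξ,
      (Set.pairwise_sUnion hchain.directedOn).2 fun E hE => (hc hE).inner_eq_zero⟩,
      fun E hE => Set.subset_sUnion_of_mem hE⟩
  refine ⟨E, hE.prop, ?_⟩
  rw [← Submodule.orthogonal_eq_bot_iff, Submodule.eq_bot_iff]
  intro ξ hξ
  by_contra h0
  have hperp : ∀ ζ ∈ E, ∀ y ∈ M.commutant, inner ℂ (y ζ) ξ = 0 := fun ζ hζ y hy =>
    hξ _ (M.commutant_apply_mem_cyclicSpace hζ hy)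
  have hins : M.IsCyclicallyOrthogonal (insert ξ E) := by
    refine ⟨?_, (Set.pairwise_insert).2 ⟨hE.prop.inner_eq_zero, fun ζ hζ _ => ⟨?_, ?_⟩⟩⟩
    · rintro ζ (rfl | hζ)
      exacts [h0, hE.prop.ne_zero ζ hζ]
    · intro y hy
      rw [← inner_conj_symm, hperp ζ hζ y hy, map_zero]
    · intro y hy
      rw [← ContinuousLinearMap.adjoint_inner_left, ← ContinuousLinearMap.star_eq_adjoint]
      exact hperp ζ hζ _ (star_mem hy)
  have hmem : ξ ∈ E := hE.le_of_ge hins (Set.subset_insert _ _) (Set.mem_insert _ _)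
  exact h0 (inner_self_eq_zero.1 (hperp ξ hmem 1 (one_mem _)))

variable {M} in
theorem IsCyclicallyOrthogonal.cyclicProjection_apply_eq_zero {E : Set H}
    (hE : M.IsCyclicallyOrthogonal E) {A : Set H} (hA : A ⊆ E) {ξ : H} (hξ : ξ ∈ E) (hξA : ξ ∉ A) :
    (M.cyclicProjection A : H →L[ℂ] H) ξ = 0 := by
  refine (Submodule.starProjection_apply_eq_zero_iff _).2
    (M.mem_orthogonal_cyclicSpace fun y hy ζ hζ => ?_)
  rw [← inner_conj_symm, hE.inner_eq_zero hξ (hA hζ) (by rintro rfl; exact hξA hζ) y hy, map_zero]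

variable {M} in
/-- In a σ-finite algebra the cyclic projections of an orthogonal family form a countable set, and
distinct vectors of the family have distinct projections. -/
theorem IsCyclicallyOrthogonal.countable {E : Set H} (hE : M.IsCyclicallyOrthogonal E)
    (hM : M.IsSigmaFinite) : E.Countable := by
  let p : H → M.toStarSubalgebra := fun ξ => M.cyclicProjection {ξ}
  have hmul : ∀ ξ ∈ E, ∀ ζ ∈ E, ξ ≠ ζ → p ξ * p ζ = 0 := fun ξ hξ ζ hζ hne => by
    have hle : M.cyclicSpace {ζ} ≤ (M.cyclicSpace {ξ})ᗮ := by
      refine M.cyclicSpace_le (Submodule.isClosed_orthogonal _) ?_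
      rintro y hy _ rfl
      refine M.mem_orthogonal_cyclicSpace ?_
      rintro z hz _ rfl
      rw [← ContinuousLinearMap.adjoint_inner_right, ← ContinuousLinearMap.star_eq_adjoint]
      exact hE.inner_eq_zero hξ hζ hne _ (mul_mem (star_mem hz) hy)
    ext v
    exact (Submodule.starProjection_apply_eq_zero_iff _).2
      (hle (Submodule.starProjection_apply_mem _ _))
  have hself : ∀ ξ, (p ξ : H →L[ℂ] H) ξ = ξ := fun ξ =>
    Submodule.starProjection_eq_self_iff.2 (M.mem_cyclicSpace rfl)
  have hinj : Set.InjOn p E := by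
    intro ξ hξ ζ hζ h
    by_contra hne
    have h0 := hmul ξ hξ ζ hζ hne
    rw [← h, (M.isStarProjection_cyclicProjection {ξ}).isIdempotentElem.eq] at h0
    refine hE.ne_zero ξ hξ ?_
    rw [← hself ξ]
    simp [p, h0]
  refine Set.countable_of_injective_of_countable_image hinj (hM _ ?_ ?_)
  · rintro _ ⟨ξ, -, rfl⟩
    exact M.isStarProjection_cyclicProjection _
  · rintro _ ⟨ξ, hξ, rfl⟩ _ ⟨ζ, hζ, rfl⟩ hne
    exact hmul ξ hξ ζ hζ fun h => hne (h ▸ rfl)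

variable {M} in
/-- In the density statement, `ξ` may be restricted to a set that generates `H` under the
commutant. -/
theorem dense_of_symVectorFunctional_mem_of_cyclicSpace_eq_top {E : Set H}
    (hE : M.cyclicSpace E = ⊤) (V : Submodule ℝ M.SelfAdjointPredual)
    (h : ∀ (ξ : E) (η : H), M.symVectorFunctional ξ η ∈ V.topologicalClosure) :
    Dense (V : Set M.SelfAdjointPredual) := by
  refine M.dense_of_symVectorFunctional_mem V fun ξ η => ?_
  let W : Submodule ℂ H :=
    { carrier := {ξ | ∀ η, M.symVectorFunctional ξ η ∈ V.topologicalClosure}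
      zero_mem' := fun η => by
        rw [symVectorFunctional_comm, map_zero]
        exact zero_mem _
      add_mem' := fun {ξ ζ} hξ hζ η => by
        rw [symVectorFunctional_comm, map_add, symVectorFunctional_comm _ η,
          symVectorFunctional_comm _ η]
        exact add_mem (hξ η) (hζ η)
      smul_mem' := fun c ξ hξ η => by
        rw [symVectorFunctional_smul_left]
        exact hξ _ }
  have hW : IsClosed (W : Set H) := by
    have : (W : Set H) = ⋂ η, M.symVectorFunctional η ⁻¹' V.topologicalClosure := by
      ext ξ
      simp only [Set.mem_iInter, Set.mem_preimage, SetLike.mem_coe, M.symVectorFunctional_comm _ ξ]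
      rfl
    rw [this]
    exact isClosed_iInter fun η =>
      (Submodule.isClosed_topologicalClosure _).preimage (M.symVectorFunctional η).continuous
  have htop : M.cyclicSpace E ≤ W := M.cyclicSpace_le hW fun y hy ξ hξ η => by
    rw [M.symVectorFunctional_commutant hy]
    exact h ⟨ξ, hξ⟩ _
  exact htop (hE ▸ Submodule.mem_top) η

/-! ### Compressions by finitely many cyclic projections -/

variable {M} in
theorem tendsto_cyclicProjection_apply {E : Set H} (hE : M.cyclicSpace E = ⊤) (v : H) :
    Tendsto (fun F : Finset E => (M.cyclicProjection (Subtype.val '' (F : Set E)) : H →L[ℂ] H) v)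
      atTop (𝓝 v) := by
  refine Submodule.starProjection_tendsto_self
    (fun F : Finset E => M.cyclicSpace (Subtype.val '' (F : Set E)))
    (fun F G h => M.cyclicSpace_mono (Set.image_mono (Finset.coe_subset.2 h))) v ?_
  rw [← hE]
  refine M.cyclicSpace_le (Submodule.isClosed_topologicalClosure _) fun y hy ξ hξ =>
    Submodule.le_topologicalClosure _ (Submodule.mem_iSup_of_mem {⟨ξ, hξ⟩}
      (M.commutant_apply_mem_cyclicSpace (by simp) hy))

/-- The compression of `x` to the invariant subspace generated by `A`. -/
noncomputable def compression (A : Set H) (x : M.toStarSubalgebra) : M.toStarSubalgebra :=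
  M.cyclicProjection A * x * M.cyclicProjection A

theorem norm_compression_le (A : Set H) (x : M.toStarSubalgebra) : ‖M.compression A x‖ ≤ ‖x‖ :=
  calc ‖M.compression A x‖ ≤ ‖M.cyclicProjection A‖ * ‖x‖ * ‖M.cyclicProjection A‖ :=
        (norm_mul_le _ _).trans (by gcongr; exact norm_mul_le _ _)
    _ ≤ 1 * ‖x‖ * 1 := by gcongr <;> exact M.norm_cyclicProjection_le A
    _ = ‖x‖ := by ring

theorem vectorFunctional_compression (A : Set H) (x : M.toStarSubalgebra) (ξ η : H) :
    M.vectorFunctional ξ η (M.compression A x) =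
      inner ℂ ((M.cyclicProjection A : H →L[ℂ] H) η)
        ((x : H →L[ℂ] H) ((M.cyclicProjection A : H →L[ℂ] H) ξ)) :=
  (Submodule.inner_starProjection_left_eq_right _ _ _).symm

variable {M} in
/-- Normality enters here: a normal functional is recovered from its values on finite
compressions. -/
theorem tendsto_apply_compression {E : Set H} (hE : M.cyclicSpace E = ⊤)
    {φ : StrongDual ℂ M.toStarSubalgebra} (hφ : φ ∈ M.predual) (x : M.toStarSubalgebra) :
    Tendsto (fun F : Finset E => φ (M.compression (Subtype.val '' (F : Set E)) x))
      atTop (𝓝 (φ x)) := by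
  let N : Submodule ℂ (StrongDual ℂ M.toStarSubalgebra) :=
    { carrier := {φ | Tendsto (fun F : Finset E =>
        φ (M.compression (Subtype.val '' (F : Set E)) x)) atTop (𝓝 (φ x))}
      zero_mem' := by simp
      add_mem' := fun {φ ψ} hφ hψ => Tendsto.add hφ hψ
      smul_mem' := fun c φ hφ => Tendsto.const_smul hφ c }
  have hclosed : IsClosed (N : Set (StrongDual ℂ M.toStarSubalgebra)) := by
    refine isClosed_of_closure_subset fun φ hφ => ?_
    refine Metric.tendsto_nhds.2 fun ε hε => ?_
    have hδ : 0 < ε / 3 / (‖x‖ + 1) := by positivity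
    obtain ⟨ψ, hψ, hd⟩ := Metric.mem_closure_iff.1 hφ _ hδ
    have hclose : ∀ z : M.toStarSubalgebra, ‖z‖ ≤ ‖x‖ → dist (φ z) (ψ z) < ε / 3 := fun z hz => by
      rw [dist_eq_norm] at hd ⊢
      calc ‖φ z - ψ z‖ = ‖(φ - ψ) z‖ := rfl
        _ ≤ ‖φ - ψ‖ * ‖z‖ := (φ - ψ).le_opNorm z
        _ ≤ ‖φ - ψ‖ * (‖x‖ + 1) := by gcongr; linarith
        _ < ε / 3 := (lt_div_iff₀ (by positivity)).1 hd
    filter_upwards [Metric.tendsto_nhds.1 hψ (ε / 3) (by positivity)] with F hF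
    have h1 := hclose _ (M.norm_compression_le (Subtype.val '' (F : Set E)) x)
    have h2 := hclose x le_rfl
    have h3 := dist_triangle4 (φ (M.compression (Subtype.val '' (F : Set E)) x))
      (ψ (M.compression (Subtype.val '' (F : Set E)) x)) (ψ x) (φ x)
    rw [dist_comm (ψ x)] at h3
    linarith
  have hN : M.predual ≤ N := by
    refine Submodule.topologicalClosure_minimal _ (Submodule.span_le.2 ?_) hclosed
    rintro _ ⟨ξ, η, rfl⟩
    change Tendsto _ _ _
    simp only [vectorFunctional_compression]
    exact (tendsto_cyclicProjection_apply hE η).inner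
      (((x : H →L[ℂ] H).continuous.tendsto _).comp (tendsto_cyclicProjection_apply hE ξ))
  exact hN hφ

/-- The real part of the evaluation at `x ∈ M`, a functional on the self-adjoint part of the
predual. -/
noncomputable def evalRe (x : M.toStarSubalgebra) : StrongDual ℝ M.SelfAdjointPredual :=
  LinearMap.mkContinuous
    { toFun := fun m => (M.toDual m x).re
      map_add' := fun m n => by simp
      map_smul' := fun c m => by simp } ‖x‖ (fun m => by
    refine (Complex.abs_re_le_norm _).trans ?_
    rw [mul_comm]
    exact (M.toDual m).le_opNorm x)

theorem evalRe_apply (x : M.toStarSubalgebra) (m : M.SelfAdjointPredual) :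
    M.evalRe x m = (M.toDual m x).re := rfl

theorem norm_evalRe_le (x : M.toStarSubalgebra) : ‖M.evalRe x‖ ≤ ‖x‖ :=
  LinearMap.mkContinuous_norm_le _ (norm_nonneg _) _

/-- Evaluations at finite compressions suffice for a subspace of the dual to be 1-norming. -/
theorem isOneNormingSubspace_of_evalRe_compression_mem {E : Set H} (hE : M.cyclicSpace E = ⊤)
    {D : Submodule ℝ (StrongDual ℝ M.SelfAdjointPredual)}
    (hD : ∀ (F : Finset E) x, M.evalRe (M.compression (Subtype.val '' (F : Set E)) x) ∈ D) :
    IsOneNormingSubspace D := by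
  intro m
  refine le_antisymm (dualSubspaceNorm_le _ _) ?_
  have hnonneg : 0 ≤ dualSubspaceNorm D m :=
    le_csSup (bddAbove_dualSubspaceNorm D m) ⟨0, zero_mem _, by simp, by simp⟩
  refine ContinuousLinearMap.opNorm_le_bound _ hnonneg fun x => ?_
  -- rotate `x` so that the value of the functional becomes its absolute value
  obtain ⟨c, hc, hcx⟩ := RCLike.exists_norm_eq_mul_self (M.toDual m x)
  have hlim := (Complex.continuous_re.tendsto _).comp
    (tendsto_apply_compression hE (M.toDual_mem_predual m) (c • x))
  rw [map_smul, smul_eq_mul, ← hcx] at hlim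
  refine le_of_tendsto hlim (Eventually.of_forall fun F => ?_)
  rw [mul_comm]
  refine (le_abs_self _).trans (norm_apply_le_mul_dualSubspaceNorm (hD F (c • x)) (norm_nonneg x)
    ((M.norm_evalRe_le _).trans ((M.norm_compression_le _ _).trans ?_)) m)
  rw [norm_smul, hc, one_mul]

/-! ### The Plichko property -/

-- `H` regarded as a real Hilbert space with inner product `re ⟨·, ·⟩`
attribute [local instance] InnerProductSpace.complexToReal

/-- The evaluation at a compression to the span of the `[M' ξ]`, `ξ ∈ F`, vanishes on the range of
`symVectorFunctional ξ` for every other `ξ` in the family. -/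
theorem evalRe_compression_mem {E : Set H} (hE : M.IsCyclicallyOrthogonal E) {ι : Type*}
    (b : HilbertBasis ι ℝ H) (F : Finset E) (x : M.toStarSubalgebra) :
    M.evalRe (M.compression (Subtype.val '' (F : Set E)) x) ∈
      countablySupported {m | ∃ (ξ : E) (j : ι), m = M.symVectorFunctional ξ (b j)} := by
  set f := M.evalRe (M.compression (Subtype.val '' (F : Set E)) x)
  have hcount : (⋃ ξ ∈ F, (fun j => M.symVectorFunctional ξ (b j)) ''
      {j | (f.comp (M.symVectorFunctional ξ)) (b j) ≠ 0}).Countable :=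
    F.countable_toSet.biUnion fun ξ _ => (b.orthonormal.countable_apply_ne_zero _).image _
  refine hcount.mono ?_
  rintro _ ⟨⟨ξ, j, rfl⟩, hne⟩
  have hξ : ξ ∈ F := by
    by_contra hξ
    refine hne ?_
    have h0 : (M.cyclicProjection (Subtype.val '' (F : Set E)) : H →L[ℂ] H) ξ = 0 :=
      hE.cyclicProjection_apply_eq_zero (by rintro _ ⟨ζ, -, rfl⟩; exact ζ.2) ξ.2 (by simpa using hξ)
    rw [evalRe_apply, toDual_symVectorFunctional, add_apply, vectorFunctional_compression,
      vectorFunctional_compression, h0]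
    simp
  exact Set.mem_biUnion hξ ⟨j, hne, rfl⟩

theorem isOnePlichko_predualSA : IsOnePlichko ℝ M.SelfAdjointPredual := by
  obtain ⟨E, hE, htop⟩ := M.exists_isCyclicallyOrthogonal_cyclicSpace_eq_top
  obtain ⟨s, b, -⟩ := exists_hilbertBasis ℝ H
  have hD := M.isOneNormingSubspace_of_evalRe_compression_mem htop (M.evalRe_compression_mem hE b)
  refine ⟨_, hD, hD.isNormingSubspace, _, ?_, fun f => Iff.rfl⟩
  exact dense_span_of_hilbertBasis (fun ξ : E => M.symVectorFunctional ξ)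
    (dense_of_symVectorFunctional_mem_of_cyclicSpace_eq_top htop) b (fun _ => 1)
    (fun _ => one_ne_zero) fun ξ j => ⟨ξ, j, one_smul _ _⟩

/-! ### σ-finiteness -/

variable {M}

theorem IsSigmaFinite.isWCG_predualSA (hM : M.IsSigmaFinite) : IsWCG ℝ M.SelfAdjointPredual := by
  obtain ⟨E, hE, htop⟩ := M.exists_isCyclicallyOrthogonal_cyclicSpace_eq_top
  have : Countable E := hE.countable hM
  exact isWCG_of_countable_hilbert (fun ξ : E => M.symVectorFunctional ξ)
    (dense_of_symVectorFunctional_mem_of_cyclicSpace_eq_top htop)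

theorem IsSigmaFinite.isWLD_predualSA (hM : M.IsSigmaFinite) : IsWLD ℝ M.SelfAdjointPredual := by
  obtain ⟨E, hE, htop⟩ := M.exists_isCyclicallyOrthogonal_cyclicSpace_eq_top
  have : Countable E := hE.countable hM
  exact isWLD_of_countable_hilbert (fun ξ : E => M.symVectorFunctional ξ)
    (dense_of_symVectorFunctional_mem_of_cyclicSpace_eq_top htop)

/-- Splitting a finite sum by the sign of its terms reduces the bound to evaluations at sums of
orthogonal projections, which are projections. -/
theorem sum_norm_evalRe_le {P : Set M.toStarSubalgebra} (hP : ∀ p ∈ P, IsStarProjection p)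
    (hortho : P.Pairwise fun p q => p * q = 0) (F : Finset P) (m : M.SelfAdjointPredual) :
    ∑ p ∈ F, ‖M.evalRe p m‖ ≤ 2 * ‖m‖ := by
  have hsum : ∀ G : Finset P, |∑ p ∈ G, M.evalRe p m| ≤ ‖m‖ := fun G => by
    have hproj : IsStarProjection (∑ p ∈ G, (p : M.toStarSubalgebra)) := by
      classical
      induction G using Finset.induction_on with
      | empty => simp
      | insert p G hpG ih =>
        rw [Finset.sum_insert hpG]
        refine (hP p p.2).add ih ?_
        rw [Finset.mul_sum]
        refine Finset.sum_eq_zero fun q hq => hortho p.2 q.2 fun h => ?_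
        exact hpG (Subtype.ext h ▸ hq)
    have h1 : ∑ p ∈ G, M.evalRe p m = M.evalRe (∑ p ∈ G, (p : M.toStarSubalgebra)) m := by
      simp [evalRe_apply]
    rw [h1]
    calc _ ≤ ‖M.evalRe (∑ p ∈ G, (p : M.toStarSubalgebra))‖ * ‖m‖ := (M.evalRe _).le_opNorm m
      _ ≤ 1 * ‖m‖ := by
        gcongr
        exact (M.norm_evalRe_le _).trans hproj.norm_le
      _ = ‖m‖ := one_mul _
  have hsplit := Finset.sum_filter_add_sum_filter_not F (fun p => 0 ≤ M.evalRe p m)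
    (fun p => ‖M.evalRe p m‖)
  rw [← hsplit, two_mul]
  refine add_le_add ?_ ?_
  · refine le_trans (le_of_eq ?_) ((le_abs_self _).trans (hsum (F.filter fun p => 0 ≤ M.evalRe p m)))
    exact Finset.sum_congr rfl fun p hp => abs_of_nonneg (Finset.mem_filter.1 hp).2
  · refine le_trans (le_of_eq ?_) ((neg_le_abs _).trans (hsum (F.filter fun p => ¬ 0 ≤ M.evalRe p m)))
    rw [← Finset.sum_neg_distrib]
    exact Finset.sum_congr rfl fun p hp => abs_of_neg (not_le.1 (Finset.mem_filter.1 hp).2)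

theorem isSigmaFinite_of_isWLD_predualSA (h : IsWLD ℝ M.SelfAdjointPredual) : M.IsSigmaFinite := by
  intro P hP hortho
  obtain ⟨-, S, hS, hcount⟩ := h
  have hcount' : ∀ f : StrongDual ℝ M.SelfAdjointPredual, {m ∈ S | f m ≠ 0}.Countable :=
    fun f => (hcount f).1 trivial
  have hQP : P \ {0} ⊆ P := Set.sdiff_subset
  -- a nonzero projection fixes some nonzero vector
  have hvec : ∀ p : (P \ {0} : Set M.toStarSubalgebra), ∃ v : H, v ≠ 0 ∧
      ((p : M.toStarSubalgebra) : H →L[ℂ] H) v = v := fun p => by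
    obtain ⟨w, hw⟩ : ∃ w, ((p : M.toStarSubalgebra) : H →L[ℂ] H) w ≠ 0 := by
      by_contra! hall
      exact p.2.2 (Subtype.ext (ContinuousLinearMap.ext hall))
    exact ⟨_, hw, DFunLike.congr_fun
      (congrArg Subtype.val (hP p (hQP p.2)).isIdempotentElem.eq) w⟩
  choose v hv0 hpv using hvec
  have hQ : Countable (P \ {0} : Set M.toStarSubalgebra) := by
    refine countable_of_biorthogonal hS hcount' (fun p => M.evalRe p) (C := 2)
      (sum_norm_evalRe_le (fun p hp => hP p (hQP hp)) (hortho.mono hQP))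
      (fun p => M.symVectorFunctional (v p) (v p)) (fun p => ?_) fun p q hpq => ?_
    · have hre : (inner ℂ (v p) (v p)).re = ‖v p‖ ^ 2 := inner_self_eq_norm_sq (𝕜 := ℂ) (v p)
      have hpos : 0 < ‖v p‖ := norm_pos_iff.2 (hv0 p)
      rw [evalRe_apply, symVectorFunctional_apply, hpv, Complex.add_re, hre]
      positivity
    · have hz : ((q : M.toStarSubalgebra) : H →L[ℂ] H) (v p) = 0 := by
        have h0 := hortho (hQP q.2) (hQP p.2) fun h => hpq (Subtype.ext h.symm)
        rw [← hpv p]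
        exact DFunLike.congr_fun (congrArg Subtype.val h0) (v p)
      rw [evalRe_apply, symVectorFunctional_apply, hz]
      simp
  exact ((Set.countable_coe_iff.1 hQ).union (Set.countable_singleton 0)).mono fun p hp => by
    by_cases h0 : p = 0 <;> simp [h0, hp]

end VonNeumannAlgebra

theorem theorem2 {H : Type*} [NormedAddCommGroup H] [InnerProductSpace ℂ H] [CompleteSpace H]
    (M : VonNeumannAlgebra H) :
    IsOnePlichko ℝ M.predualSA ∧
      (IsWLD ℝ M.predualSA ↔ M.IsSigmaFinite) ∧
      (M.IsSigmaFinite → IsWCG ℝ M.predualSA) :=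
  ⟨M.isOnePlichko_predualSA,
    ⟨VonNeumannAlgebra.isSigmaFinite_of_isWLD_predualSA, fun h => h.isWLD_predualSA⟩,
    fun h => h.isWCG_predualSA⟩
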